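/- Let $\mathbf Y$ and $\mathbf B$ be Borel spaces (i.e. homeomorphic to Borel subsets of Polish spaces), $Q(dy|x,b)$ a stochastic kernel on $\mathbf Y$ given $\mathbf Y\times\mathbf B$, and $C:\mathbf Y\times\mathbf B\to[0,\infty]$ a measurable cost function. A strategy $\pi=\{\pi_i\}_{i\ge1}$ is a sequence of stochastic kernels $\pi_i$ on $\mathbf B$ given the histories $(y_0,b_1,y_1,\dots,b_{i-1},y_{i-1})$. For an initial state $y$, let $\mathsf P^\pi_y$ (with expectation $\mathsf E^\pi_y$) be the law on $(\mathbf Y\times\mathbf B)^\infty$ of the process $Y_0,B_1,Y_1,B_2,\dots$ with $Y_0=y$, $B_i\sim\pi_i(\cdot|Y_0,B_1,\dots,Y_{i-1})$ and $Y_i\sim Q(\cdot|Y_{i-1},B_i)$. A measurable map $f:\mathbf Y\to\mathbf B$ is identified with the deterministic stationary strategy $\pi_i(db|y_0,b_1,\dots,y_{i-1})=\delta_{f(y_{i-1})}(db)$. Put $$\mathcal V(y,\pi)=\mathsf E^\pi_y\Big[\sum_{i=1}^\infty C(Y_{i-1},B_i)\Big],\qquad \mathcal V^*(y)=\inf_\pi\mathcal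 V(y,\pi),$$ the infimum being over all strategies. Suppose that the MDP is semicontinuous: $\mathbf B$ is compact; for every bounded continuous $u:\mathbf Y\to\mathbb R$ the function $(x,b)\mapsto\int_{\mathbf Y}u(y)\,Q(dy|x,b)$ is continuous on $\mathbf Y\times\mathbf B$; and $C$ is lower semicontinuous. Suppose that $\mathbf Y=\mathbf V\cup\{\Delta\}$, where $\Delta\notin\mathbf V$ is an isolated costless cemetery: $\{\Delta\}$ is open in $\mathbf Y$, and $Q(\{\Delta\}|\Delta,b)=1$ and $C(\Delta,b)=0$ for all $b\in\mathbf B$. Let $y_0\in\mathbf V$, and let $f$ be a deterministic stationary strategy that is optimal from $y_0$, i.e. $\mathcal V(y_0,f)=\mathcal V^*(y_0)$, where $\mathcal V^*(y_0)<\infty$. For a strategy $\pi$ let $$\mu^\pi(\Gamma)=\mathsf E^\pi_{y_0}\Big[\sum_{i=0}^\infty\mathbb I\{(Y_i,B_{i+1})\in\Gamma\}\Big],\qquad \Gamma\in\mathcal B(\mathbf Y\times\mathbf B),$$ be its occupation measure. Then $\mathcal V^*(\Delta)=0$ and $\mathcal V(y_0,f)=\int_{\mathbf V}C(y,f(y))\,\mu^f(dy\times\mathbf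 B)$, and there is a deterministic stationary strategy $\tilde f$ with $\tilde f(\Delta)=f(\Delta)$ that is uniformly optimal, $$\mathcal V(y,\tilde f)=\mathcal V^*(y)\quad\text{for all }y\in\mathbf Y,$$ and whose occupation measure satisfies $\mu^{\tilde f}=\mu^f$ on $\mathbf V\times\mathbf B$. -/

import Mathlib

open MeasureTheory ProbabilityTheory

universe u v

/-- A topological space is a *Borel space* if it is homeomorphic to a Borel subset of a Polish
space. -/
def IsBorelSubsetOfPolish (Y : Type u) [TopologicalSpace Y] : Prop :=
  ∃ (Z : Type u) (_ : TopologicalSpace Z) (_ : PolishSpace Z) (e : Y → Z),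
    Topology.IsEmbedding e ∧ MeasurableSet[borel Z] (Set.range e)

/-- A Markov decision process with state space `Y`, action space `B`, transition law `Q(dy | x, b)`
and a single `[0, ∞]`-valued measurable one-step cost `C`. -/
structure MDP (Y : Type u) (B : Type v) [MeasurableSpace Y] [MeasurableSpace B] where
  /-- The transition law. -/
  Q : Kernel (Y × B) Y
  isMarkovKernel_Q : IsMarkovKernel Q
  /-- The one-step cost. -/
  C : Y × B → ENNReal
  measurable_C : Measurable C

attribute [instance] MDP.isMarkovKernel_Q

/-- The space of `n`-histories `(x₀, b₁, x₁, b₂, …, bₙ, xₙ)`, written as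
`((x₀, b₁), (x₁, b₂), …, (xₙ₋₁, bₙ))` together with the current state `xₙ`. -/
abbrev History (Y : Type u) (B : Type v) (n : ℕ) : Type (max u v) :=
  (Fin n → Y × B) × Y

/-- A (randomized, history-dependent) strategy: `kernel n` is the stochastic kernel `π_{n+1}` on
`B` given the `n`-histories. -/
structure Strategy (Y : Type u) (B : Type v) [MeasurableSpace Y] [MeasurableSpace B] where
  kernel : ∀ n : ℕ, Kernel (History Y B n) B
  isMarkovKernel_kernel : ∀ n : ℕ, IsMarkovKernel (kernel n)

attribute [instance] Strategy.isMarkovKernel_kernel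

/-- The deterministic stationary strategy given by a measurable map `f`:
`π_{n+1}(db | x₀, b₁, …, xₙ) = δ_{f(xₙ)}(db)`. -/
noncomputable def Strategy.detStationary {Y : Type u} {B : Type v}
    [MeasurableSpace Y] [MeasurableSpace B] (f : Y → B) (hf : Measurable f) : Strategy Y B where
  kernel _ := Kernel.deterministic (fun h => f h.2) (hf.comp measurable_snd)
  isMarkovKernel_kernel _ := inferInstance

namespace MDP

variable {Y : Type u} {B : Type v}

section Strategic

variable [MeasurableSpace Y] [MeasurableSpace B]

/-- A trajectory `ω : ℕ → Y × B` is `ω i = (Xᵢ, Bᵢ₊₁)`. This is the conditional law of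
`(Xₙ₊₁, Bₙ₊₂)` given `(X₀, B₁), …, (Xₙ, Bₙ₊₁)` under the strategy `π`: first
`Xₙ₊₁ ∼ Q(· | Xₙ, Bₙ₊₁)`, then `Bₙ₊₂ ∼ π_{n+2}(· | X₀, B₁, …, Xₙ, Bₙ₊₁, Xₙ₊₁)`. -/
noncomputable def stepKernel (M : MDP Y B) (π : Strategy Y B) (n : ℕ) :
    Kernel (∀ _ : Finset.Iic n, Y × B) (Y × B) :=
  Kernel.compProd
    (M.Q.comap (fun h => h ⟨n, Finset.mem_Iic.2 le_rfl⟩) (measurable_pi_apply _))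
    ((π.kernel (n + 1)).comap
      (fun p : (∀ _ : Finset.Iic n, Y × B) × Y =>
        ((fun i : Fin (n + 1) => p.1 ⟨i, Finset.mem_Iic.2 (Nat.lt_succ_iff.1 i.2)⟩, p.2) :
          History Y B (n + 1)))
      ((measurable_pi_lambda _ fun _ =>
        (measurable_pi_apply _).comp measurable_fst).prodMk measurable_snd))

instance (M : MDP Y B) (π : Strategy Y B) (n : ℕ) : IsMarkovKernel (M.stepKernel π n) := by
  unfold stepKernel; infer_instance

/-- The law of `(X₀, B₁)`: `X₀ = y` and `B₁ ∼ π₁(· | y)`. -/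
noncomputable def initialLaw (π : Strategy Y B) (y : Y) : Measure (Y × B) :=
  (π.kernel 0 (Fin.elim0, y)).map (fun b => (y, b))

/-- The strategic measure `P^π_y` on the space of trajectories, given by the Ionescu-Tulcea
theorem. -/
noncomputable def strategicMeasure (M : MDP Y B) (π : Strategy Y B) (y : Y) :
    Measure (ℕ → Y × B) :=
  Kernel.trajMeasure (X := fun _ => Y × B) (initialLaw π y) (M.stepKernel π)

/-- The performance measure `E^π_y [∑_{i ≥ 1} C(X_{i-1}, B_i)]`. -/
noncomputable def value (M : MDP Y B) (π : Strategy Y B) (y : Y) : ENNReal :=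
  ∫⁻ ω, ∑' i : ℕ, M.C (ω i) ∂(M.strategicMeasure π y)

/-- The Bellman function: the infimum of the performance measure over all strategies. -/
noncomputable def bellman (M : MDP Y B) (y : Y) : ENNReal :=
  ⨅ π : Strategy Y B, M.value π y

/-- The occupation measure `Γ ↦ E^π_y [∑_{i ≥ 0} 1{(X_i, B_{i+1}) ∈ Γ}]`, i.e. the sum over `i` of
the laws of `(X_i, B_{i+1})`. -/
noncomputable def occupationMeasure (M : MDP Y B) (π : Strategy Y B) (y : Y) :
    Measure (Y × B) :=
  Measure.sum fun i : ℕ => (M.strategicMeasure π y).map (fun ω => ω i)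

/-- `Δ` is a costless cemetery: it is absorbing under every action, and no cost is incurred
there. -/
structure IsCostlessCemetery (M : MDP Y B) (Δ : Y) : Prop where
  absorbing : ∀ b : B, M.Q (Δ, b) {Δ} = 1
  costless : ∀ b : B, M.C (Δ, b) = 0

end Strategic

/-- A semicontinuous MDP: compact action space, weakly continuous transition law, lower
semicontinuous cost. -/
structure IsSemicontinuous [TopologicalSpace Y] [MeasurableSpace Y] [TopologicalSpace B]
    [MeasurableSpace B] (M : MDP Y B) : Prop where
  compactSpace : CompactSpace B
  continuous_integral : ∀ u : BoundedContinuousFunction Y ℝ,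
    Continuous fun p : Y × B => ∫ y, u y ∂(M.Q p)
  lowerSemicontinuous_cost : LowerSemicontinuous M.C

end MDP

/-!
The Bellman function is the limit `W` of value iteration from `0`, and both halves of the theorem
are read off from the Bellman equation `W x = min_b (C (x, b) + ∫ W dQ(· | x, b))`.

*Existence of minimizers.* With `B` compact, `Q` weakly continuous and `C` lower semicontinuous, all
iterates are lower semicontinuous (`LowerSemicontinuous.lintegral_kernel`,
`LowerSemicontinuous.iInf_snd`); the minimum commutes with the increasing limit
(`exists_iSup_le_of_forall_iInf_le`), and minimizers can be chosen measurably
(`LowerSemicontinuous.exists_measurable_argmin`). A stationary strategy that attains the minimum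
everywhere costs at most `W` (`MDP.value_detStationary_le`), and no strategy costs less
(`MDP.valueLimit_le_bellman`). Hence `W` is the Bellman function and every everywhere-minimizing
stationary strategy is uniformly optimal.

*Optimality from one point.* If `f` is optimal from `y₀` with finite cost, then the inequality
`W ≤ C + Q W` along `f` cannot be strict with positive probability at any time: `f x` attains the
minimum at almost every visited state `x` (`MDP.ae_costToGo_eq_of_optimal`). Keep `f` where it
attains the minimum, which includes `Δ`, and use a measurable minimizer elsewhere. The new strategy
minimizes everywhere, and it differs from `f` only at states that are almost surely never visited
from `y₀`, so all state-action laws, and with them the occupation measure, are unchanged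
(`MDP.stateActionLaw_congr`).

The strategic measures enter only through the laws of the pairs `(Xₙ, Bₙ₊₁)`: the state marginal at
time `n + 1` is the image of the law at time `n` under `Q`, and under a stationary strategy the law
is determined by its state marginal.
-/

open Filter Topology
open scoped ENNReal

/-! ### Lower semicontinuous functions on a product with a compact factor -/

section Semicontinuity

variable {X K : Type*} [TopologicalSpace X] [TopologicalSpace K] [CompactSpace K]

theorem LowerSemicontinuous.exists_eq_iInf [Nonempty K] {φ : K → ℝ≥0∞}
    (hφ : LowerSemicontinuous φ) : ∃ b, φ b = ⨅ b', φ b' := by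
  obtain ⟨b, -, hb⟩ := LowerSemicontinuousOn.exists_isMinOn (s := Set.univ) Set.univ_nonempty
    isCompact_univ (hφ.lowerSemicontinuousOn _)
  exact ⟨b, le_antisymm (le_iInf fun b' => hb (Set.mem_univ b')) (iInf_le _ b)⟩

theorem LowerSemicontinuous.iInf_snd [Nonempty K] {φ : X × K → ℝ≥0∞}
    (hφ : LowerSemicontinuous φ) : LowerSemicontinuous fun x => ⨅ b, φ (x, b) := by
  rw [lowerSemicontinuous_iff_isClosed_preimage]
  intro c
  have key : (fun x => ⨅ b, φ (x, b)) ⁻¹' Set.Iic c = Prod.fst '' (φ ⁻¹' Set.Iic c) := by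
    ext x
    simp only [Set.mem_preimage, Set.mem_Iic, Set.mem_image, Prod.exists, exists_and_right,
      exists_eq_right]
    constructor
    · intro h
      obtain ⟨b, hb⟩ := (hφ.comp (Continuous.prodMk_right x)).exists_eq_iInf
      exact ⟨b, hb.trans_le h⟩
    · rintro ⟨b, hb⟩
      exact (iInf_le _ b).trans hb
  rw [key]
  exact isClosedMap_fst_of_compactSpace _ (hφ.isClosed_preimage c)

/-- On a compact space, the infimum commutes with the supremum of an increasing sequence of lower
semicontinuous functions; the sublevel sets are nested nonempty compact sets. -/
theorem exists_iSup_le_of_forall_iInf_le [Nonempty K] {φ : ℕ → K → ℝ≥0∞}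
    (hφ : ∀ n, LowerSemicontinuous (φ n)) (hmono : Monotone φ) {c : ℝ≥0∞}
    (hc : ∀ n, ⨅ b, φ n b ≤ c) : ∃ b, ⨆ n, φ n b ≤ c := by
  obtain ⟨b, hb⟩ := IsCompact.nonempty_iInter_of_sequence_nonempty_isCompact_isClosed
    (fun n => φ n ⁻¹' Set.Iic c)
    (fun n b hb => (hmono n.le_succ b).trans hb)
    (fun n => by
      obtain ⟨b, hb⟩ := (hφ n).exists_eq_iInf
      exact ⟨b, hb.trans_le (hc n)⟩)
    ((hφ 0).isClosed_preimage c).isCompact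
    (fun n => (hφ n).isClosed_preimage c)
  exact ⟨b, iSup_le fun n => Set.mem_iInter.1 hb n⟩

/-- **Measurable selection of minimizers.** The compact space `B` is a continuous image of the
Cantor set in `ℝ`, and the least point of the Cantor set whose image minimizes `φ (x, ·)` depends
measurably on `x`. -/
theorem LowerSemicontinuous.exists_measurable_argmin [MeasurableSpace X] [OpensMeasurableSpace X]
    {B : Type*} [TopologicalSpace B] [TopologicalSpace.MetrizableSpace B] [CompactSpace B]
    [Nonempty B] [MeasurableSpace B] [BorelSpace B] {φ : X × B → ℝ≥0∞}
    (hφ : LowerSemicontinuous φ) :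
    ∃ g : X → B, Measurable g ∧ ∀ x, φ (x, g x) = ⨅ b, φ (x, b) := by
  let := TopologicalSpace.metrizableSpaceMetric B
  obtain ⟨p₀, hp₀, hp₀s⟩ := exists_nat_bool_continuous_surjective_of_compact B
  obtain ⟨p, hp, hps⟩ : ∃ p : cantorSet → B, Continuous p ∧ Function.Surjective p :=
    ⟨p₀ ∘ cantorSetHomeomorphNatToBool, hp₀.comp cantorSetHomeomorphNatToBool.continuous,
      hp₀s.comp cantorSetHomeomorphNatToBool.surjective⟩
  have : CompactSpace cantorSet := isCompact_iff_compactSpace.1 isCompact_cantorSet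
  have hψ : LowerSemicontinuous fun q : X × cantorSet => φ (q.1, p q.2) :=
    hφ.comp (continuous_fst.prodMk (hp.comp continuous_snd))
  have hψx (x : X) : LowerSemicontinuous fun k : cantorSet => φ (x, p k) :=
    hψ.comp (Continuous.prodMk_right x)
  set m : X → ℝ≥0∞ := fun x => ⨅ b, φ (x, b) with hm
  have hm_meas : Measurable m := hφ.iInf_snd.measurable
  have hleast (x : X) : ∃ k : cantorSet, φ (x, p k) ≤ m x ∧
      ∀ k' : cantorSet, φ (x, p k') ≤ m x → k ≤ k' := by
    have hne : ((fun k : cantorSet => φ (x, p k)) ⁻¹' Set.Iic (m x)).Nonempty := by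
      have : Nonempty cantorSet := hps.nonempty
      obtain ⟨b, hb⟩ := (hφ.comp (Continuous.prodMk_right x)).exists_eq_iInf
      obtain ⟨k, rfl⟩ := hps b
      exact ⟨k, hb.le⟩
    obtain ⟨k, hk, hk'⟩ := ((hψx x).isClosed_preimage (m x)).isCompact.exists_isLeast hne
    exact ⟨k, hk, fun k' h => hk' h⟩
  choose s hs hs' using hleast
  have hs_meas : Measurable s := by
    refine Measurable.subtype_mk (f := fun x => (s x : ℝ)) (measurable_of_Iic fun c => ?_)
    let T : Set cantorSet := {k | (k : ℝ) ≤ c}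
    rcases isEmpty_or_nonempty T with hT | hT
    · convert MeasurableSet.empty
      exact Set.eq_empty_of_forall_notMem fun x hx => hT.false ⟨s x, hx⟩
    have : CompactSpace T := isCompact_iff_compactSpace.1
      (isClosed_le continuous_subtype_val continuous_const).isCompact
    have hlsc : LowerSemicontinuous fun q : X × T => φ (q.1, p q.2) :=
      hψ.comp (continuous_fst.prodMk (continuous_subtype_val.comp continuous_snd))
    -- The least minimizer is at most `c` iff the minimum over the compact set `T` is `m x`.
    have key : (fun x => (s x : ℝ)) ⁻¹' Set.Iic c = {x | ⨅ k : T, φ (x, p k) ≤ m x} := by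
      ext x
      constructor
      · intro h
        exact (iInf_le (fun k : T => φ (x, p k)) ⟨s x, h⟩).trans (hs x)
      · intro h
        obtain ⟨k, hk⟩ := (hlsc.comp (Continuous.prodMk_right x)).exists_eq_iInf
        have hle : s x ≤ k := hs' x k (hk.trans_le h)
        exact le_trans (Subtype.coe_le_coe.2 hle) k.2
    rw [key]
    exact measurableSet_le hlsc.iInf_snd.measurable hm_meas
  exact ⟨p ∘ s, hp.measurable.comp hs_meas, fun x => le_antisymm (hs x) (iInf_le _ _)⟩

end Semicontinuity

/-! ### Integrals of lower semicontinuous functions against weakly continuous kernels -/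

section WeakContinuity

variable {X Y : Type*} [TopologicalSpace X] [MeasurableSpace X]
  [TopologicalSpace Y] [TopologicalSpace.PseudoMetrizableSpace Y] [MeasurableSpace Y] [BorelSpace Y]

theorem lowerSemicontinuous_kernel_apply_of_isOpen (κ : Kernel X Y) [IsMarkovKernel κ]
    (hκ : ∀ u : BoundedContinuousFunction Y ℝ, Continuous fun x => ∫ y, u y ∂(κ x))
    {G : Set Y} (hG : IsOpen G) : LowerSemicontinuous fun x => κ x G := by
  let := TopologicalSpace.pseudoMetrizableSpacePseudoMetric Y
  rw [lowerSemicontinuous_iff_le_liminf]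
  intro x
  let P : X → ProbabilityMeasure Y := fun x => ⟨κ x, inferInstance⟩
  have hP : Tendsto P (𝓝 x) (𝓝 (P x)) :=
    ProbabilityMeasure.tendsto_iff_forall_integral_tendsto.2 fun u => (hκ u).tendsto x
  exact ProbabilityMeasure.le_liminf_measure_open_of_tendsto hP hG

/-- The portmanteau theorem for lower semicontinuous integrands: truncate, apply the layer cake
formula, and use Fatou's lemma in the layer parameter. -/
theorem LowerSemicontinuous.lintegral_kernel [FirstCountableTopology X] (κ : Kernel X Y)
    [IsMarkovKernel κ]
    (hκ : ∀ u : BoundedContinuousFunction Y ℝ, Continuous fun x => ∫ y, u y ∂(κ x))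
    {w : Y → ℝ≥0∞} (hw : LowerSemicontinuous w) :
    LowerSemicontinuous fun x => ∫⁻ y, w y ∂(κ x) := by
  have htrunc (N : ℕ) : LowerSemicontinuous fun x => ∫⁻ y, min (w y) N ∂(κ x) := by
    have htop (y : Y) : min (w y) N ≠ ∞ := ne_top_of_le_ne_top (by simp) (min_le_right _ _)
    have hmeas : Measurable fun y => (min (w y) (N : ℝ≥0∞)).toReal :=
      (hw.measurable.min measurable_const).ennreal_toReal
    have hcake (x : X) : ∫⁻ y, min (w y) N ∂(κ x) =
        ∫⁻ t in Set.Ioi (0 : ℝ), κ x {y | t < (min (w y) (N : ℝ≥0∞)).toReal} := by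
      rw [← lintegral_eq_lintegral_meas_lt (κ x)
        (Eventually.of_forall fun y => ENNReal.toReal_nonneg) hmeas.aemeasurable]
      exact lintegral_congr fun y => (ENNReal.ofReal_toReal (htop y)).symm
    simp_rw [hcake]
    rw [lowerSemicontinuous_iff_le_liminf]
    intro x
    refine le_trans ?_ (lintegral_liminf_le fun x' => Antitone.measurable fun s t hst =>
      measure_mono fun y hy => lt_of_le_of_lt hst hy)
    refine setLIntegral_mono' measurableSet_Ioi fun t ht => ?_
    have hopen : IsOpen {y | t < (min (w y) (N : ℝ≥0∞)).toReal} := by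
      have : {y | t < (min (w y) (N : ℝ≥0∞)).toReal} =
          w ⁻¹' Set.Ioi (ENNReal.ofReal t) ∩ {_y | ENNReal.ofReal t < N} := by
        ext y
        simp only [Set.mem_ofPred_eq, Set.mem_inter_iff, Set.mem_preimage, Set.mem_Ioi,
          ← lt_min_iff]
        exact (ENNReal.ofReal_lt_iff_lt_toReal (le_of_lt ht) (htop y)).symm
      rw [this]
      exact (hw.isOpen_preimage _).inter isOpen_const
    exact lowerSemicontinuous_iff_le_liminf.1
      (lowerSemicontinuous_kernel_apply_of_isOpen κ hκ hopen) x
  have hsup (y : Y) : w y = ⨆ N : ℕ, min (w y) N := by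
    rw [← inf_iSup_eq, ENNReal.iSup_natCast, inf_top_eq]
  have heq : (fun x => ∫⁻ y, w y ∂(κ x)) = fun x => ⨆ N : ℕ, ∫⁻ y, min (w y) N ∂(κ x) := by
    ext x
    rw [← lintegral_iSup (fun N => hw.measurable.min measurable_const)
      (fun M N h y => min_le_min_left _ (by exact_mod_cast h))]
    exact lintegral_congr hsup
  rw [heq]
  exact lowerSemicontinuous_iSup htrunc

end WeakContinuity

namespace MDP

variable {Y : Type u} {B : Type v}

/-! ### Laws of the state-action pairs along a trajectory -/

section Laws

variable [MeasurableSpace Y] [MeasurableSpace B]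

/-- The law of `(Xₙ, Bₙ₊₁)` under the strategic measure `P^π_y`. -/
noncomputable def stateActionLaw (M : MDP Y B) (π : Strategy Y B) (y : Y) (n : ℕ) :
    Measure (Y × B) :=
  (M.strategicMeasure π y).map fun ω => ω n

variable (M : MDP Y B) (π : Strategy Y B) (y : Y)

instance : IsProbabilityMeasure (initialLaw π y) := by
  unfold initialLaw
  exact Measure.isProbabilityMeasure_map (by fun_prop)

instance : IsProbabilityMeasure (M.strategicMeasure π y) := by
  unfold strategicMeasure
  infer_instance

theorem stateActionLaw_zero : M.stateActionLaw π y 0 = initialLaw π y := by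
  have h : (Kernel.traj (X := fun _ => Y × B) (M.stepKernel π) 0).map (fun ω => ω 0) =
      Kernel.deterministic (fun h => h ⟨0, Finset.mem_Iic.2 le_rfl⟩) (measurable_pi_apply _) := by
    have h0 := Kernel.traj_map_frestrictLe (X := fun _ => Y × B) (κ := M.stepKernel π) 0 0
    rw [Kernel.partialTraj_self] at h0
    have h1 := congrArg (fun κ => Kernel.map κ
      (fun h : (∀ _ : Finset.Iic 0, Y × B) => h ⟨0, Finset.mem_Iic.2 le_rfl⟩)) h0
    rw [← Kernel.map_comp_right _ (by fun_prop) (by fun_prop)] at h1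
    refine h1.trans ?_
    rw [Kernel.id_map]
  unfold stateActionLaw strategicMeasure Kernel.trajMeasure
  rw [Measure.map_comp _ _ (by fun_prop), h, Measure.deterministic_comp_eq_map,
    Measure.map_map (by fun_prop) (by fun_prop)]
  exact Measure.map_id

theorem lintegral_stepKernel (n : ℕ) (h : ∀ _ : Finset.Iic n, Y × B) {g : Y × B → ℝ≥0∞}
    (hg : Measurable g) :
    ∫⁻ p, g p ∂(M.stepKernel π n h) =
      ∫⁻ x, ∫⁻ b, g (x, b) ∂(π.kernel (n + 1)
        (fun i : Fin (n + 1) => h ⟨i, Finset.mem_Iic.2 (Nat.lt_succ_iff.1 i.2)⟩, x))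
        ∂(M.Q (h ⟨n, Finset.mem_Iic.2 le_rfl⟩)) := by
  unfold stepKernel
  rw [Kernel.lintegral_compProd _ _ _ hg]
  rfl

theorem lintegral_stateActionLaw_succ (n : ℕ) {g : Y × B → ℝ≥0∞} (hg : Measurable g) :
    ∫⁻ p, g p ∂(M.stateActionLaw π y (n + 1)) =
      ∫⁻ ω, ∫⁻ p, g p ∂(M.stepKernel π n (Preorder.frestrictLe n ω))
        ∂(M.strategicMeasure π y) := by
  have h := Kernel.map_frestrictLe_trajMeasure_compProd_eq_map_trajMeasure
    (X := fun _ => Y × B) (κ := M.stepKernel π) (μ₀ := initialLaw π y) (a := n)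
  have h' : M.stateActionLaw π y (n + 1) =
      (((M.strategicMeasure π y).map (Preorder.frestrictLe n)) ⊗ₘ M.stepKernel π n).map
        Prod.snd := by
    unfold strategicMeasure
    rw [h, Measure.map_map (by fun_prop) (by fun_prop)]
    rfl
  rw [h', lintegral_map hg measurable_snd, Measure.lintegral_compProd (by fun_prop),
    lintegral_map (Measurable.lintegral_kernel hg) (by fun_prop)]

/-- Whatever the strategy, the next state is drawn from the transition law. -/
theorem lintegral_fst_stateActionLaw_succ (n : ℕ) {w : Y → ℝ≥0∞} (hw : Measurable w) :
    ∫⁻ x, w x ∂(M.stateActionLaw π y (n + 1)).fst =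
      ∫⁻ p, ∫⁻ x, w x ∂(M.Q p) ∂(M.stateActionLaw π y n) := by
  rw [Measure.fst, lintegral_map hw measurable_fst,
    lintegral_stateActionLaw_succ M π y n (g := fun p => w p.1) (by fun_prop), stateActionLaw,
    lintegral_map (Measurable.lintegral_kernel hw) (measurable_pi_apply n)]
  refine lintegral_congr fun ω => ?_
  rw [lintegral_stepKernel M π n _ (g := fun p => w p.1) (by fun_prop)]
  simp

theorem fst_stateActionLaw_zero : (M.stateActionLaw π y 0).fst = Measure.dirac y := by
  rw [stateActionLaw_zero, initialLaw, Measure.fst, Measure.map_map measurable_fst (by fun_prop)]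
  change Measure.map (fun _ => y) _ = _
  simp

variable {f : Y → B} (hf : Measurable f)

/-- Under a deterministic stationary strategy, the state-action laws live on the graph. -/
theorem stateActionLaw_detStationary (n : ℕ) :
    M.stateActionLaw (Strategy.detStationary f hf) y n =
      ((M.stateActionLaw (Strategy.detStationary f hf) y n).fst).map fun x => (x, f x) := by
  have hgraph : Measurable fun x => (x, f x) := measurable_id.prodMk hf
  cases n with
  | zero =>
    rw [fst_stateActionLaw_zero, stateActionLaw_zero, initialLaw, Measure.map_dirac' hgraph]
    change Measure.map _ (Kernel.deterministic (fun h : History Y B 0 => f h.2)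
      (hf.comp measurable_snd) _) = _
    rw [Kernel.deterministic_apply, Measure.map_dirac' (by fun_prop)]
  | succ n =>
    refine Measure.ext_of_lintegral _ fun g hg => ?_
    rw [lintegral_map hg hgraph, lintegral_fst_stateActionLaw_succ M _ y n
        (w := fun x => g (x, f x)) (hg.comp hgraph),
      lintegral_stateActionLaw_succ M _ y n hg, stateActionLaw,
      lintegral_map (Measurable.lintegral_kernel (f := fun x => g (x, f x)) (hg.comp hgraph))
        (measurable_pi_apply n)]
    refine lintegral_congr fun ω => ?_
    rw [lintegral_stepKernel M _ n _ hg]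
    refine lintegral_congr fun x => ?_
    change ∫⁻ b, g (x, b) ∂(Kernel.deterministic (fun h : History Y B (n + 1) => f h.2)
      (hf.comp measurable_snd) _) = _
    rw [Kernel.deterministic_apply, lintegral_dirac' _ (by fun_prop)]

theorem lintegral_stateActionLaw_detStationary (n : ℕ) {g : Y × B → ℝ≥0∞} (hg : Measurable g) :
    ∫⁻ p, g p ∂(M.stateActionLaw (Strategy.detStationary f hf) y n) =
      ∫⁻ x, g (x, f x) ∂(M.stateActionLaw (Strategy.detStationary f hf) y n).fst := by
  conv_lhs => rw [stateActionLaw_detStationary M y hf n]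
  exact lintegral_map hg (measurable_id.prodMk hf)

/-- Changing a stationary strategy only at states that are almost surely never visited does not
change the state-action laws. -/
theorem stateActionLaw_congr {f' : Y → B} (hf' : Measurable f')
    (h : ∀ n, ∀ᵐ x ∂(M.stateActionLaw (Strategy.detStationary f hf) y n).fst, f' x = f x)
    (n : ℕ) :
    M.stateActionLaw (Strategy.detStationary f' hf') y n =
      M.stateActionLaw (Strategy.detStationary f hf) y n := by
  have hfst : (M.stateActionLaw (Strategy.detStationary f' hf') y n).fst =
      (M.stateActionLaw (Strategy.detStationary f hf) y n).fst := by
    cases n with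
    | zero => rw [fst_stateActionLaw_zero, fst_stateActionLaw_zero]
    | succ n =>
      refine Measure.ext_of_lintegral _ fun g hg => ?_
      rw [lintegral_fst_stateActionLaw_succ M _ y n hg, stateActionLaw_congr hf' h n,
        lintegral_fst_stateActionLaw_succ M _ y n hg]
  rw [stateActionLaw_detStationary M y hf' n, hfst]
  refine Eq.trans (Measure.map_congr ?_) (stateActionLaw_detStationary M y hf n).symm
  filter_upwards [h n] with x hx
  rw [hx]

theorem value_eq_tsum :
    M.value π y = ∑' i : ℕ, ∫⁻ p, M.C p ∂(M.stateActionLaw π y i) := by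
  unfold value
  have hC (i : ℕ) : Measurable fun ω : ℕ → Y × B => M.C (ω i) :=
    M.measurable_C.comp (measurable_pi_apply i)
  rw [lintegral_tsum fun i => (hC i).aemeasurable]
  refine tsum_congr fun i => ?_
  rw [stateActionLaw, lintegral_map M.measurable_C (measurable_pi_apply i)]

end Laws

/-! ### Value iteration -/

section ValueIteration

variable [MeasurableSpace Y] [MeasurableSpace B]

/-- The right-hand side `C(x, b) + ∫ w dQ(· | x, b)` of the Bellman equation. -/
noncomputable def costToGo (M : MDP Y B) (w : Y → ℝ≥0∞) (p : Y × B) : ℝ≥0∞ :=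
  M.C p + ∫⁻ x, w x ∂(M.Q p)

/-- Value iteration from `0`: the least expected cost over the first `n` steps. -/
noncomputable def valueIter (M : MDP Y B) : ℕ → Y → ℝ≥0∞
  | 0 => fun _ => 0
  | n + 1 => fun x => ⨅ b, M.costToGo (M.valueIter n) (x, b)

/-- The limit of value iteration. -/
noncomputable def valueLimit (M : MDP Y B) (x : Y) : ℝ≥0∞ :=
  ⨆ n, M.valueIter n x

variable (M : MDP Y B)

theorem costToGo_mono {w w' : Y → ℝ≥0∞} (h : w ≤ w') : M.costToGo w ≤ M.costToGo w' :=
  fun _ => add_le_add_right (lintegral_mono h) _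

theorem valueIter_monotone : Monotone M.valueIter := by
  refine monotone_nat_of_le_succ fun n => ?_
  induction n with
  | zero => exact fun x => zero_le
  | succ n ih => exact fun x => iInf_mono fun b => M.costToGo_mono ih (x, b)

theorem valueIter_le_valueLimit (n : ℕ) : M.valueIter n ≤ M.valueLimit :=
  fun x => le_iSup (fun n => M.valueIter n x) n

theorem valueLimit_le_costToGo (p : Y × B) : M.valueLimit p.1 ≤ M.costToGo M.valueLimit p := by
  refine iSup_le fun n => ?_
  cases n with
  | zero => exact zero_le
  | succ n =>
    exact (iInf_le _ p.2).trans (M.costToGo_mono (M.valueIter_le_valueLimit n) p)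

theorem lintegral_costToGo {w : Y → ℝ≥0∞} (hw : Measurable w) (π : Strategy Y B) (y : Y) (n : ℕ) :
    ∫⁻ p, M.costToGo w p ∂(M.stateActionLaw π y n) =
      ∫⁻ p, M.C p ∂(M.stateActionLaw π y n) +
        ∫⁻ x, w x ∂(M.stateActionLaw π y (n + 1)).fst := by
  unfold costToGo
  rw [lintegral_add_left M.measurable_C, lintegral_fst_stateActionLaw_succ M π y n hw]

variable {M}

theorem lintegral_valueIter_le (hv : ∀ n, Measurable (M.valueIter n)) (π : Strategy Y B) (y : Y)
    (k m : ℕ) :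
    ∫⁻ x, M.valueIter k x ∂(M.stateActionLaw π y m).fst ≤
      ∑ i ∈ Finset.range k, ∫⁻ p, M.C p ∂(M.stateActionLaw π y (m + i)) := by
  induction k generalizing m with
  | zero => simp [valueIter]
  | succ k ih =>
    calc ∫⁻ x, M.valueIter (k + 1) x ∂(M.stateActionLaw π y m).fst
        = ∫⁻ p, M.valueIter (k + 1) p.1 ∂(M.stateActionLaw π y m) :=
          lintegral_map (hv _) measurable_fst
      _ ≤ ∫⁻ p, M.costToGo (M.valueIter k) p ∂(M.stateActionLaw π y m) :=
          lintegral_mono fun p => iInf_le _ p.2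
      _ = ∫⁻ p, M.C p ∂(M.stateActionLaw π y m) +
            ∫⁻ x, M.valueIter k x ∂(M.stateActionLaw π y (m + 1)).fst :=
          M.lintegral_costToGo (hv k) π y m
      _ ≤ _ := by
          rw [Finset.sum_range_succ', add_comm, add_zero]
          refine add_le_add_left ((ih (m + 1)).trans_eq (Finset.sum_congr rfl fun i _ => ?_)) _
          rw [add_assoc, add_comm 1]

/-- The expectation of the limit of value iteration is at most the expected remaining cost. -/
theorem lintegral_valueLimit_le (hv : ∀ n, Measurable (M.valueIter n)) (π : Strategy Y B) (y : Y)
    (m : ℕ) :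
    ∫⁻ x, M.valueLimit x ∂(M.stateActionLaw π y m).fst ≤
      ∑' i, ∫⁻ p, M.C p ∂(M.stateActionLaw π y (m + i)) := by
  unfold valueLimit
  rw [lintegral_iSup hv M.valueIter_monotone]
  exact iSup_le fun k => (lintegral_valueIter_le hv π y k m).trans (ENNReal.sum_le_tsum _)

theorem valueLimit_le_bellman (hv : ∀ n, Measurable (M.valueIter n)) (y : Y) :
    M.valueLimit y ≤ M.bellman y := by
  refine le_iInf fun π => ?_
  have h := lintegral_valueLimit_le hv π y 0
  rw [fst_stateActionLaw_zero,
    lintegral_dirac' _ (show Measurable M.valueLimit from Measurable.iSup hv)] at h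
  simpa [value_eq_tsum] using h

/-- A stationary strategy along which `w` does not increase in expectation, costs included, costs
at most `w`. -/
theorem value_detStationary_le {w : Y → ℝ≥0∞} (hw : Measurable w) {g : Y → B} (hg : Measurable g)
    (h : ∀ x, M.costToGo w (x, g x) ≤ w x) (y : Y) :
    M.value (Strategy.detStationary g hg) y ≤ w y := by
  have hr : Measurable (M.costToGo w) := M.measurable_C.add (Measurable.lintegral_kernel hw)
  have hbound (n : ℕ) :
      ∑ i ∈ Finset.range n, ∫⁻ p, M.C p ∂(M.stateActionLaw (Strategy.detStationary g hg) y i) +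
        ∫⁻ x, w x ∂(M.stateActionLaw (Strategy.detStationary g hg) y n).fst ≤ w y := by
    induction n with
    | zero =>
      rw [fst_stateActionLaw_zero, lintegral_dirac' _ hw]
      simp
    | succ n ih =>
      rw [Finset.sum_range_succ, add_assoc, ← M.lintegral_costToGo hw,
        lintegral_stateActionLaw_detStationary M y hg n hr]
      exact (add_le_add_right (lintegral_mono h) _).trans ih
  rw [value_eq_tsum, ENNReal.tsum_eq_iSup_nat]
  exact iSup_le fun n => le_self_add.trans (hbound n)

/-- If `f` is optimal from `y` with finite cost, then the Bellman equation holds with the action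
`f x` at almost every visited state `x`. -/
theorem ae_costToGo_eq_of_optimal (hv : ∀ n, Measurable (M.valueIter n)) {f : Y → B}
    (hf : Measurable f) {y : Y} (hopt : M.value (Strategy.detStationary f hf) y ≤ M.valueLimit y)
    (hfin : M.valueLimit y ≠ ∞) (n : ℕ) :
    ∀ᵐ x ∂(M.stateActionLaw (Strategy.detStationary f hf) y n).fst,
      M.costToGo M.valueLimit (x, f x) = M.valueLimit x := by
  set π := Strategy.detStationary f hf
  have hw : Measurable M.valueLimit := Measurable.iSup hv
  have hr : Measurable (M.costToGo M.valueLimit) :=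
    M.measurable_C.add (Measurable.lintegral_kernel hw)
  set c : ℕ → ℝ≥0∞ := fun i => ∫⁻ p, M.C p ∂(M.stateActionLaw π y i)
  set a : ℕ → ℝ≥0∞ := fun i => ∫⁻ x, M.valueLimit x ∂(M.stateActionLaw π y i).fst
  have ha0 : a 0 = M.valueLimit y := by
    simp only [a, fst_stateActionLaw_zero, lintegral_dirac' _ hw]
  have hr_int (i : ℕ) : ∫⁻ x, M.costToGo M.valueLimit (x, f x) ∂(M.stateActionLaw π y i).fst =
      c i + a (i + 1) := by
    rw [← lintegral_stateActionLaw_detStationary M y hf i hr, M.lintegral_costToGo hw]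
  have hstep (i : ℕ) : a i ≤ c i + a (i + 1) := by
    rw [← hr_int]
    exact lintegral_mono fun x => M.valueLimit_le_costToGo (x, f x)
  have htail (i : ℕ) : a i ≤ ∑' j, c (i + j) := lintegral_valueLimit_le hv π y i
  have hsplit (i : ℕ) : ∑ j ∈ Finset.range i, c j + ∑' j, c (i + j) ≤ a 0 := by
    rw [ha0]
    refine le_trans (le_of_eq ?_) hopt
    rw [value_eq_tsum]
    simp_rw [add_comm i]
    exact ENNReal.summable.sum_add_tsum_nat_add' (f := c) (k := i)
  have hhead (i : ℕ) : a 0 ≤ ∑ j ∈ Finset.range i, c j + a i := by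
    induction i with
    | zero => simp
    | succ i ih =>
      rw [Finset.sum_range_succ, add_assoc]
      exact ih.trans (add_le_add_right (hstep i) _)
  have hsum_ne (i : ℕ) : ∑ j ∈ Finset.range i, c j ≠ ∞ :=
    ne_top_of_le_ne_top (ha0 ▸ hfin) (le_self_add.trans (hsplit i))
  have ha_ne : a n ≠ ∞ :=
    ne_top_of_le_ne_top (ha0 ▸ hfin) ((htail n).trans (le_add_self.trans (hsplit n)))
  -- The cost of the first `n` steps is finite and can be cancelled.
  have hle : c n + a (n + 1) ≤ a n := by
    rw [← ENNReal.add_le_add_iff_left (hsum_ne n), ← add_assoc, ← Finset.sum_range_succ]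
    exact ((add_le_add_right (htail (n + 1)) _).trans (hsplit (n + 1))).trans (hhead n)
  have hae := ae_eq_of_ae_le_of_lintegral_le
    (Eventually.of_forall fun x => M.valueLimit_le_costToGo (x, f x)) ha_ne
    (hr.comp (measurable_id.prodMk hf)).aemeasurable ((hr_int n).trans_le hle)
  filter_upwards [hae] with x hx using hx.symm

end ValueIteration

end MDP

/-! ### Uniformly optimal selectors in semicontinuous models -/

section BorelSpaces

theorem IsBorelSubsetOfPolish.metrizableSpace {Y : Type u} [TopologicalSpace Y]
    (h : IsBorelSubsetOfPolish Y) : TopologicalSpace.MetrizableSpace Y := by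
  obtain ⟨Z, _, _, e, he, -⟩ := h
  exact he.metrizableSpace

theorem IsBorelSubsetOfPolish.secondCountableTopology {Y : Type u} [TopologicalSpace Y]
    (h : IsBorelSubsetOfPolish Y) : SecondCountableTopology Y := by
  obtain ⟨Z, _, _, e, he, -⟩ := h
  exact he.secondCountableTopology

end BorelSpaces

namespace MDP

variable {Y : Type u} {B : Type v}

section Semicontinuous

variable [TopologicalSpace Y] [TopologicalSpace.MetrizableSpace Y] [MeasurableSpace Y]
  [BorelSpace Y] [TopologicalSpace B] [TopologicalSpace.MetrizableSpace B] [MeasurableSpace B]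
  {M : MDP Y B}

theorem IsSemicontinuous.costToGo (hM : M.IsSemicontinuous) {w : Y → ℝ≥0∞}
    (hw : LowerSemicontinuous w) : LowerSemicontinuous (M.costToGo w) :=
  hM.lowerSemicontinuous_cost.add (hw.lintegral_kernel M.Q hM.continuous_integral)

variable [Nonempty B]

theorem IsSemicontinuous.valueIter (hM : M.IsSemicontinuous) (n : ℕ) :
    LowerSemicontinuous (M.valueIter n) := by
  have := hM.compactSpace
  induction n with
  | zero => exact lowerSemicontinuous_const
  | succ n ih => exact (hM.costToGo ih).iInf_snd

theorem IsSemicontinuous.valueLimit (hM : M.IsSemicontinuous) :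
    LowerSemicontinuous M.valueLimit :=
  lowerSemicontinuous_iSup hM.valueIter

theorem IsSemicontinuous.exists_costToGo_valueLimit_le (hM : M.IsSemicontinuous) (x : Y) :
    ∃ b, M.costToGo M.valueLimit (x, b) ≤ M.valueLimit x := by
  have := hM.compactSpace
  obtain ⟨b, hb⟩ := exists_iSup_le_of_forall_iInf_le
    (φ := fun n b => M.costToGo (M.valueIter n) (x, b)) (c := M.valueLimit x)
    (fun n => (hM.costToGo (hM.valueIter n)).comp (Continuous.prodMk_right x))
    (fun m n h b => M.costToGo_mono (M.valueIter_monotone h) (x, b))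
    (fun n => M.valueIter_le_valueLimit (n + 1) x)
  refine ⟨b, le_trans (le_of_eq ?_) hb⟩
  simp only [MDP.costToGo, MDP.valueLimit]
  rw [lintegral_iSup (fun n => (hM.valueIter n).measurable) M.valueIter_monotone, ENNReal.add_iSup]

theorem IsSemicontinuous.exists_measurable_selector [BorelSpace B] (hM : M.IsSemicontinuous) :
    ∃ g : Y → B, Measurable g ∧ ∀ x, M.costToGo M.valueLimit (x, g x) ≤ M.valueLimit x := by
  have := hM.compactSpace
  obtain ⟨g, hg, hmin⟩ := (hM.costToGo hM.valueLimit).exists_measurable_argmin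
  refine ⟨g, hg, fun x => ?_⟩
  obtain ⟨b, hb⟩ := hM.exists_costToGo_valueLimit_le x
  exact (hmin x).trans_le ((iInf_le _ b).trans hb)

/-- A stationary strategy whose actions attain the minimum in the Bellman equation everywhere is
uniformly optimal. -/
theorem IsSemicontinuous.value_eq_bellman (hM : M.IsSemicontinuous) {g : Y → B}
    (hg : Measurable g) (h : ∀ x, M.costToGo M.valueLimit (x, g x) ≤ M.valueLimit x) (y : Y) :
    M.value (Strategy.detStationary g hg) y = M.bellman y :=
  le_antisymm
    ((value_detStationary_le hM.valueLimit.measurable hg h y).trans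
      (valueLimit_le_bellman (fun n => (hM.valueIter n).measurable) y))
    (iInf_le _ _)

theorem IsSemicontinuous.bellman_eq_valueLimit [BorelSpace B] (hM : M.IsSemicontinuous) (y : Y) :
    M.bellman y = M.valueLimit y := by
  obtain ⟨g, hg, h⟩ := hM.exists_measurable_selector
  exact le_antisymm
    ((iInf_le _ _).trans (value_detStationary_le hM.valueLimit.measurable hg h y))
    (valueLimit_le_bellman (fun n => (hM.valueIter n).measurable) y)

end Semicontinuous

/-! ### Costless cemeteries -/

section Cemetery

variable [MeasurableSpace Y] [MeasurableSpace B] [MeasurableSingletonClass Y] {M : MDP Y B} {Δ : Y}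

theorem IsCostlessCemetery.costToGo_eq (hΔ : M.IsCostlessCemetery Δ) (w : Y → ℝ≥0∞) (b : B) :
    M.costToGo w (Δ, b) = w Δ := by
  have hQ : ∀ᵐ x ∂(M.Q (Δ, b)), w x = w Δ := by
    have h : ∀ᵐ x ∂(M.Q (Δ, b)), x ∈ ({Δ} : Set Y) :=
      (prob_compl_eq_zero_iff (measurableSet_singleton Δ)).2 (hΔ.absorbing b)
    filter_upwards [h] with x hx
    rw [Set.mem_singleton_iff.1 hx]
  rw [costToGo, hΔ.costless, zero_add, lintegral_congr_ae hQ]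
  simp

theorem IsCostlessCemetery.valueLimit_eq_zero [Nonempty B] (hΔ : M.IsCostlessCemetery Δ) :
    M.valueLimit Δ = 0 := by
  have h (n : ℕ) : M.valueIter n Δ = 0 := by
    induction n with
    | zero => rfl
    | succ n ih => simp only [valueIter, hΔ.costToGo_eq, ih, ciInf_const]
  simp [valueLimit, h]

end Cemetery

/-! ### Occupation measures -/

theorem fst_occupationMeasure [MeasurableSpace Y] [MeasurableSpace B] (M : MDP Y B)
    (π : Strategy Y B) (y : Y) :
    (M.occupationMeasure π y).fst = Measure.sum fun i => (M.stateActionLaw π y i).fst :=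
  Measure.map_sum measurable_fst.aemeasurable

theorem value_detStationary_eq_lintegral_occupationMeasure [MeasurableSpace Y] [MeasurableSpace B]
    (M : MDP Y B) {f : Y → B} (hf : Measurable f) (y : Y) :
    M.value (Strategy.detStationary f hf) y =
      ∫⁻ x, M.C (x, f x) ∂(M.occupationMeasure (Strategy.detStationary f hf) y).fst := by
  rw [value_eq_tsum, fst_occupationMeasure, lintegral_sum_measure]
  exact tsum_congr fun i => lintegral_stateActionLaw_detStationary M y hf i M.measurable_C

end MDP

/-! ### Optimality from one state -/

theorem lemma5p3 {Y : Type u} {B : Type v}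
    [TopologicalSpace Y] [MeasurableSpace Y] [BorelSpace Y] (hY : IsBorelSubsetOfPolish Y)
    [TopologicalSpace B] [MeasurableSpace B] [BorelSpace B] (hB : IsBorelSubsetOfPolish B)
    (M : MDP Y B) (hM : M.IsSemicontinuous)
    (Δ : Y) (hΔ_isolated : IsOpen ({Δ} : Set Y)) (hΔ : M.IsCostlessCemetery Δ)
    (y₀ : Y) (hy₀ : y₀ ≠ Δ)
    (f : Y → B) (hf : Measurable f)
    (hf_opt : M.value (Strategy.detStationary f hf) y₀ = M.bellman y₀)
    (h_fin : M.bellman y₀ < ⊤) :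
    M.bellman Δ = 0 ∧
    M.value (Strategy.detStationary f hf) y₀ =
      ∫⁻ y in {Δ}ᶜ, M.C (y, f y) ∂(M.occupationMeasure (Strategy.detStationary f hf) y₀).fst ∧
    ∃ (f' : Y → B) (hf' : Measurable f'),
      f' Δ = f Δ ∧
      (∀ y : Y, M.value (Strategy.detStationary f' hf') y = M.bellman y) ∧
      (M.occupationMeasure (Strategy.detStationary f hf) y₀).restrict ({Δ}ᶜ ×ˢ Set.univ) =
        (M.occupationMeasure (Strategy.detStationary f' hf') y₀).restrict ({Δ}ᶜ ×ˢ Set.univ) := by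
  have := hY.metrizableSpace
  have := hY.secondCountableTopology
  have := hB.metrizableSpace
  have := hB.secondCountableTopology
  have : Nonempty B := ⟨f y₀⟩
  have hv (n : ℕ) : Measurable (M.valueIter n) := (hM.valueIter n).measurable
  have hw : Measurable M.valueLimit := hM.valueLimit.measurable
  have hWΔ : M.valueLimit Δ = 0 := hΔ.valueLimit_eq_zero
  refine ⟨by rw [hM.bellman_eq_valueLimit, hWΔ], ?_, ?_⟩
  · rw [MDP.value_detStationary_eq_lintegral_occupationMeasure]
    refine (setLIntegral_eq_of_support_subset ?_).symm
    rintro x hx rfl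
    exact hx (hΔ.costless _)
  classical
  obtain ⟨g, hg, hgW⟩ := hM.exists_measurable_selector
  -- `S` is the set of states at which `f` attains the minimum in the Bellman equation.
  let S : Set Y := {x | M.costToGo M.valueLimit (x, f x) = M.valueLimit x}
  have hS : MeasurableSet S := by
    have hr : Measurable fun x => M.costToGo M.valueLimit (x, f x) :=
      (hM.costToGo hM.valueLimit).measurable.comp (measurable_id.prodMk hf)
    exact measurableSet_eq_fun hr hw
  have hf' : Measurable (S.piecewise f g) := hf.piecewise hS hg
  have hfW (x : Y) : M.costToGo M.valueLimit (x, S.piecewise f g x) ≤ M.valueLimit x := by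
    by_cases hx : x ∈ S
    · rw [Set.piecewise_eq_of_mem _ _ _ hx]
      exact le_of_eq hx
    · rw [Set.piecewise_eq_of_notMem _ _ _ hx]
      exact hgW x
  have hae (n : ℕ) :
      ∀ᵐ x ∂(M.stateActionLaw (Strategy.detStationary f hf) y₀ n).fst, S.piecewise f g x = f x := by
    rw [hM.bellman_eq_valueLimit] at hf_opt h_fin
    filter_upwards [MDP.ae_costToGo_eq_of_optimal hv hf hf_opt.le h_fin.ne n] with x hx
    exact Set.piecewise_eq_of_mem _ _ _ hx
  refine ⟨S.piecewise f g, hf', ?_, hM.value_eq_bellman hf' hfW, ?_⟩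
  · exact Set.piecewise_eq_of_mem _ _ _ (hΔ.costToGo_eq _ _)
  · have hocc : M.occupationMeasure (Strategy.detStationary f hf) y₀ =
        M.occupationMeasure (Strategy.detStationary _ hf') y₀ :=
      congrArg Measure.sum (funext fun n => (MDP.stateActionLaw_congr M y₀ hf hf' hae n).symm)
    rw [hocc]
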